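/- Let $S$ be a finite set, $\mathbb A=S^{\mathbb N}$ the space of one-sided sequences $x=(x_0,x_1,\dots)$ with its Borel (product) $\sigma$-algebra, $\sigma(x_0,x_1,\dots)=(x_1,x_2,\dots)$ the left shift, and, for a fixed $\theta\in(0,1)$, let $d(x,y)=\theta^{\inf\{n\ge 0:\,x_n\ne y_n\}}$ (with $\theta^{\infty}=0$). Let $\varphi_p:\mathbb A\to\mathbb R$ be a potential and $\|\varphi_p\|\ge 1$ a real constant such that $$\sup_x|\varphi_p(x)|\le\|\varphi_p\|,\qquad |\varphi_p(x)-\varphi_p(y)|\le\|\varphi_p\|\,d(x,y)\quad\text{for all }x,y\in\mathbb A,$$ and assume that $\varphi_p$ is normalized: $\sum_{s\in S}e^{\varphi_p(sx)}=1$ for every $x\in\mathbb A$, where $sx=(s,x_0,x_1,\dots)$. Let $\mu$ be an equilibrium state of $\varphi_p$, that is, a $\sigma$-invariant Borel probability measure that maximizes $h_\nu(\sigma)+\int\varphi_p\,d\nu$ among all $\sigma$-invariant Borel probability measures $\nu$ on $\mathbb A$; here $h_\nu(\sigma)=\lim_n H_n(\nu)/n=\inf_{n\ge1}H_n(\nu)/n$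 is the entropy of $\nu$ and $H_n(\nu)$ is the Shannon entropy of the partition of $\mathbb A$ into cylinders of length $n$. Put $\mathbb E\varphi=\int\varphi\,d\mu$ and $(Pf)(x)=\sum_{s\in S}e^{\varphi_p(sx)}f(sx)$. Let $\varphi:\mathbb A\to\mathbb R$ be an observable and $\|\varphi\|\ge 1$ a real constant such that $\sup_x|\varphi(x)|\le\|\varphi\|$ and $|\varphi(x)-\varphi(y)|\le\|\varphi\|\,d(x,y)$ for all $x,y\in\mathbb A$. Let $$a=1-\exp\Big(-\frac{\|\varphi_p\|}{1-\theta}\Big),\qquad \epsilon\in\big(0,\min\{1-a,\,1-\theta\}\big),\qquad U=\frac{\log(1-\epsilon)}{\log[\theta\epsilon(1-\epsilon-\theta)]-\log(2\|\varphi_p\|)},$$ $$z_0\in\Big(1,\ \min\Big\{\Big(\frac{a+\epsilon/2}{a}\Big)^{U},\ \frac{\theta+\epsilon}{\theta},\ \frac{1-\epsilon}{\theta},\ e^2\Big\}\Big).$$ Then for every integer $n\ge 0$ $$\|P^n(\varphi-\mathbb E\varphi)\|_\infty=\sup_{x\in\mathbb A}\big|P^n(\varphi-\mathbb E\varphi)(x)\big|\le\frac{(\sqrt{z_0})^{-n}}{(\log\sqrt{z_0})\,(1-a-\epsilon)}\,\|\varphi\|.$$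 -/

import Mathlib

open MeasureTheory

noncomputable section

/-- The left shift `(x₀, x₁, x₂, …) ↦ (x₁, x₂, …)` on one-sided sequences of symbols. -/
def leftShift {S : Type*} (x : ℕ → S) : ℕ → S := fun n => x (n + 1)

/-- The sequence `a x = (a, x₀, x₁, …)`. -/
def prepend {S : Type*} (a : S) (x : ℕ → S) : ℕ → S
  | 0 => a
  | n + 1 => x n

open Classical in
/-- The distance `θ ^ inf {n ≥ 0 : xₙ ≠ yₙ}`, with `θ ^ ∞ = 0` when `x = y`. -/
def symbDist {S : Type*} (θ : ℝ) (x y : ℕ → S) : ℝ :=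
  if ∃ n, x n ≠ y n then θ ^ sInf {n : ℕ | x n ≠ y n} else 0

/-- `K ≥ 1` bounds both the supremum of `|f|` and the Lipschitz constant of `f`
with respect to the distance `symbDist θ`. -/
structure IsLipBound {S : Type*} (θ : ℝ) (f : (ℕ → S) → ℝ) (K : ℝ) : Prop where
  one_le : 1 ≤ K
  abs_le : ∀ x, |f x| ≤ K
  lipschitz : ∀ x y, |f x - f y| ≤ K * symbDist θ x y

/-- The potential is normalized: `∑_{a ∈ S} exp (φp (a x)) = 1` for every `x`. -/
def IsNormalized {S : Type*} [Fintype S] (φp : (ℕ → S) → ℝ) : Prop :=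
  ∀ x, ∑ a : S, Real.exp (φp (prepend a x)) = 1

/-- The transfer operator `(P f)(x) = ∑_{a ∈ S} exp (φp (a x)) f (a x)`. -/
def transferOp {S : Type*} [Fintype S] (φp f : (ℕ → S) → ℝ) : (ℕ → S) → ℝ :=
  fun x => ∑ a : S, Real.exp (φp (prepend a x)) * f (prepend a x)

/-- The Shannon entropy of the partition into cylinders of length `n`. -/
def blockEntropy {S : Type*} [Fintype S] [MeasurableSpace S]
    (μ : Measure (ℕ → S)) (n : ℕ) : ℝ :=
  ∑ w : Fin n → S, Real.negMulLog (μ.real {x | ∀ i : Fin n, x i = w i})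

/-- The measure-theoretic entropy of the shift with respect to an invariant probability `μ`:
`h(μ) = lim Hₙ / n = inf_{n ≥ 1} Hₙ / n` (block entropies of a stationary process are
subadditive, so the limit is the infimum, as in `Subadditive.lim`). -/
def shiftEntropy {S : Type*} [Fintype S] [MeasurableSpace S]
    (μ : Measure (ℕ → S)) : ℝ :=
  sInf ((fun n : ℕ => blockEntropy μ n / n) '' Set.Ici 1)

/-- `μ` is an equilibrium state of `φp`: a shift-invariant probability measure that maximizes
entropy plus the integral of `φp` among all shift-invariant probability measures. -/
structure IsEquilibriumState {S : Type*} [Fintype S] [MeasurableSpace S]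
    (φp : (ℕ → S) → ℝ) (μ : Measure (ℕ → S)) : Prop where
  isProb : IsProbabilityMeasure μ
  invariant : MeasurePreserving leftShift μ μ
  maximal : ∀ ν : Measure (ℕ → S), IsProbabilityMeasure ν → MeasurePreserving leftShift ν ν →
    shiftEntropy ν + ∫ x, φp x ∂ν ≤ shiftEntropy μ + ∫ x, φp x ∂μ

end

/-! Normalization makes `transferOp φp` the transition operator of a chain that prepends random
symbols. Run it from two points agreeing on `k` symbols: the same symbol can be prepended to both
with probability at least `q k = exp (-(Kp * θ ^ (k + 1)))`, after which they agree on `k + 1`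
symbols; otherwise the agreement is reset to `0`. Never resetting from `0` has probability at least
`∏ q k ≥ exp (-Kp / (1 - θ)) = 1 - a`, and late resets are exponentially rare. Hence, for `z = √z₀`,
the generating function of the reset time is at most `a + ε < 1`, and a renewal argument yields a
Lyapunov function `V` of the agreement length. It forces the oscillation of `P ^ n φ` to decay like
`z ^ (-n)` (`abs_iterate_transferOp_sub_le_of_params`).

To pass from oscillation to centred iterates, `μ` must satisfy `∫ P f dμ = ∫ f dμ`
(`IsEquilibriumState.integral_transferOp`). Entropy plus integral is at most `0` for every
normalized Lipschitz potential, and `φp` attains `0` at a fixed measure of the dual operator, so the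
equilibrium state attains it too. If `P g = 0`, then `φp + log (1 + t g)` is again normalized for
small `t`; comparing the two potentials at `μ` to first order in `t` gives `∫ g dμ = 0`. The choice
`g = f - (P f) ∘ σ` and invariance finish. -/

section Contraction

/-! ### Coupling and oscillation of the iterates. -/

variable {S : Type*}

lemma symbDist_le_pow {θ : ℝ} (hθ : θ ∈ Set.Ioo (0 : ℝ) 1) {k : ℕ} {x y : ℕ → S}
    (h : ∀ i < k, x i = y i) : symbDist θ x y ≤ θ ^ k := by
  unfold symbDist
  split_ifs with hne
  · refine pow_le_pow_of_le_one hθ.1.le hθ.2.le ?_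
    refine le_csInf hne fun n hn => ?_
    by_contra hlt
    exact hn (h n (not_le.mp hlt))
  · exact pow_nonneg hθ.1.le k

lemma prepend_agree {k : ℕ} {x y : ℕ → S} (h : ∀ i < k, x i = y i) (s : S) :
    ∀ i < k + 1, prepend s x i = prepend s y i := by
  intro i hi
  cases i with
  | zero => rfl
  | succ i => exact h i (by omega)

@[simp] lemma leftShift_prepend (s : S) (x : ℕ → S) : leftShift (prepend s x) = x := rfl

variable [Fintype S]

/-- One coupling step: a difference of averages with respect to two probability vectors, the
first of which dominates `q` times the second. -/
lemma abs_sum_sub_sum_le {p p' u v : S → ℝ} {q B C : ℝ}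
    (hp1 : ∑ s, p s = 1) (hp1' : ∑ s, p' s = 1) (hp' : ∀ s, 0 ≤ p' s)
    (hq0 : 0 ≤ q) (hq : ∀ s, q * p' s ≤ p s)
    (hB : ∀ s, |u s - v s| ≤ B) (hC : ∀ s t, |u s - v t| ≤ C) :
    |∑ s, p s * u s - ∑ s, p' s * v s| ≤ q * B + (1 - q) * C := by
  set w := ∑ t, p' t * v t with hw
  have hu : ∀ s, |u s - w| ≤ C := by
    intro s
    have : u s - w = ∑ t, p' t * (u s - v t) := by
      simp only [mul_sub, Finset.sum_sub_distrib, ← Finset.sum_mul, hp1', one_mul, hw]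
    rw [this]
    calc _ ≤ ∑ t, |p' t * (u s - v t)| := Finset.abs_sum_le_sum_abs _ _
      _ ≤ ∑ t, p' t * C := Finset.sum_le_sum fun t _ => by
          rw [abs_mul, abs_of_nonneg (hp' t)]
          exact mul_le_mul_of_nonneg_left (hC s t) (hp' t)
      _ = C := by rw [← Finset.sum_mul, hp1', one_mul]
  -- Mass `q` is coupled on equal symbols, distributed as `p'`; the remainder `p - q * p'`, of mass
  -- `1 - q`, is compared with the mean `w`.
  have hsplit : ∑ s, p s * u s - w
      = ∑ s, (q * (p' s * (u s - v s)) + (p s - q * p' s) * (u s - w)) := by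
    have : ∀ s, q * (p' s * (u s - v s)) + (p s - q * p' s) * (u s - w)
        = p s * u s - q * (p' s * v s) - p s * w + q * (p' s * w) := fun s => by ring
    simp only [this, Finset.sum_sub_distrib, Finset.sum_add_distrib, ← Finset.mul_sum,
      ← Finset.sum_mul, hp1, hp1', ← hw]
    ring
  rw [hsplit]
  calc _ ≤ ∑ s, |q * (p' s * (u s - v s)) + (p s - q * p' s) * (u s - w)| :=
        Finset.abs_sum_le_sum_abs _ _
    _ ≤ ∑ s, (q * (p' s * B) + (p s - q * p' s) * C) := Finset.sum_le_sum fun s _ => by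
        refine (abs_add_le _ _).trans (add_le_add ?_ ?_)
        · rw [abs_mul, abs_mul, abs_of_nonneg hq0, abs_of_nonneg (hp' s)]
          exact mul_le_mul_of_nonneg_left (mul_le_mul_of_nonneg_left (hB s) (hp' s)) hq0
        · rw [abs_mul, abs_of_nonneg (sub_nonneg.2 (hq s))]
          exact mul_le_mul_of_nonneg_left (hu s) (sub_nonneg.2 (hq s))
    _ = q * B + (1 - q) * C := by
        simp only [Finset.sum_add_distrib, ← Finset.mul_sum, ← Finset.sum_mul,
          Finset.sum_sub_distrib, hp1, hp1']
        ring

/-- Geometric decay of the oscillation of `P ^ n f`, from a drift condition on a Lyapunov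
function `V` of the number of leading symbols on which two points agree. -/
lemma abs_iterate_transferOp_sub_le {θ : ℝ} (hθ : θ ∈ Set.Ioo (0 : ℝ) 1)
    {φp f : (ℕ → S) → ℝ} {Kp K z : ℝ} (hφp : IsLipBound θ φp Kp) (hnorm : IsNormalized φp)
    (hf : IsLipBound θ f K) (hz : 0 < z) {V : ℕ → ℝ} (hV : ∀ k, θ ^ k ≤ V k)
    (hdrift : ∀ k, Real.exp (-(Kp * θ ^ (k + 1))) * V (k + 1)
      + (1 - Real.exp (-(Kp * θ ^ (k + 1)))) * V 0 ≤ V k / z) (n : ℕ) :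
    ∀ (k : ℕ) (x y : ℕ → S), (∀ i < k, x i = y i) →
      |(transferOp φp)^[n] f x - (transferOp φp)^[n] f y| ≤ K * (z ^ n)⁻¹ * V k := by
  have hK : 0 ≤ K := zero_le_one.trans hf.one_le
  have hKp : 0 ≤ Kp := zero_le_one.trans hφp.one_le
  induction n with
  | zero =>
    intro k x y h
    simpa using (hf.lipschitz x y).trans
      (mul_le_mul_of_nonneg_left ((symbDist_le_pow hθ h).trans (hV k)) hK)
  | succ n ih =>
    intro k x y h
    rw [Function.iterate_succ_apply', transferOp, transferOp]
    set g := (transferOp φp)^[n] f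
    -- Prepending a common symbol raises the agreement to `k + 1`, hence the exponent.
    have hratio : ∀ s, Real.exp (-(Kp * θ ^ (k + 1))) * Real.exp (φp (prepend s y))
        ≤ Real.exp (φp (prepend s x)) := by
      intro s
      rw [← Real.exp_add]
      apply Real.exp_le_exp.2
      have h1 := (abs_le.1 (hφp.lipschitz (prepend s x) (prepend s y))).1
      have h2 := mul_le_mul_of_nonneg_left
        (symbDist_le_pow hθ (prepend_agree h s)) hKp
      linarith
    have hc : 0 ≤ K * (z ^ n)⁻¹ := mul_nonneg hK (inv_nonneg.2 (pow_nonneg hz.le n))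
    refine (abs_sum_sub_sum_le (hnorm x) (hnorm y) (fun s => (Real.exp_pos _).le)
      (Real.exp_pos _).le hratio
      (fun s => ih (k + 1) _ _ (prepend_agree h s))
      (fun s t => ih 0 _ _ (by simp))).trans ?_
    calc _ = K * (z ^ n)⁻¹ * (Real.exp (-(Kp * θ ^ (k + 1))) * V (k + 1)
          + (1 - Real.exp (-(Kp * θ ^ (k + 1)))) * V 0) := by ring
      _ ≤ K * (z ^ n)⁻¹ * (V k / z) := mul_le_mul_of_nonneg_left (hdrift k) hc
      _ = K * (z ^ (n + 1))⁻¹ * V k := by rw [pow_succ]; field_simp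

end Contraction

/-! ### Reset times, the Lyapunov function and the choice of parameters. -/

section Lyapunov

/-- A Lyapunov function as required by `abs_iterate_transferOp_sub_le`, built from a bound `R` on
the generating function of the reset time of the coupling. -/
lemma exists_lyapunov_of_reset {θ z r : ℝ} {q R : ℕ → ℝ} (hθ : θ ∈ Set.Ioo (0 : ℝ) 1)
    (hz : 1 < z) (hzθ : z * θ < 1) (hq1 : ∀ k, q k ≤ 1)
    (hR0 : ∀ k, 0 ≤ R k) (hr : R 0 ≤ r) (hr1 : r < 1)
    (hR : ∀ k, z * ((1 - q k) + q k * R (k + 1)) ≤ R k) :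
    ∃ V : ℕ → ℝ, V 0 ≤ ((1 - z * θ) * (1 - r))⁻¹ ∧ (∀ k, θ ^ k ≤ V k) ∧
      ∀ k, q k * V (k + 1) + (1 - q k) * V 0 ≤ V k / z := by
  have h1 : 0 < 1 - z * θ := by linarith
  have h2 : 0 < 1 - R 0 := by linarith
  have hz0 : 0 < z := by linarith
  -- `V` bounds the expected sum of `z ^ j * θ ^ (agreement at time j)`: the geometric series covers
  -- the time before the first reset, `R k * V0` what follows. `V0` is the fixed point of this
  -- renewal equation at `k = 0`.
  set V0 := ((1 - z * θ) * (1 - R 0))⁻¹ with hV0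
  have hV0pos : 0 < V0 := inv_pos.2 (mul_pos h1 h2)
  have e0 : θ ^ 0 / (1 - z * θ) + R 0 * V0 = V0 := by
    rw [hV0]; field_simp; ring
  refine ⟨fun k => θ ^ k / (1 - z * θ) + R k * V0, ?_, ?_, ?_⟩
  · simp only [e0]
    rw [hV0]
    apply inv_anti₀ (mul_pos h1 (by linarith))
    exact mul_le_mul_of_nonneg_left (by linarith) h1.le
  · intro k
    have : θ ^ k ≤ θ ^ k / (1 - z * θ) := by
      rw [le_div_iff₀ h1]
      have := pow_pos hθ.1 k
      have := mul_pos hz0 hθ.1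
      nlinarith
    have := mul_nonneg (hR0 k) hV0pos.le
    simp only
    linarith
  · intro k
    simp only [e0]
    rw [le_div_iff₀ hz0]
    have hA : q k * (θ ^ (k + 1) / (1 - z * θ)) * z + θ ^ k ≤ θ ^ k / (1 - z * θ) + θ ^ k := by
      have : q k * (θ ^ (k + 1) / (1 - z * θ)) * z
          = q k * (z * θ) * (θ ^ k / (1 - z * θ)) := by rw [pow_succ]; ring
      rw [this]
      have hpos : 0 < θ ^ k / (1 - z * θ) := div_pos (pow_pos hθ.1 k) h1
      have hzθ0 := mul_pos hz0 hθ.1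
      have : q k * (z * θ) ≤ 1 := by nlinarith [hq1 k]
      nlinarith
    have hB := mul_le_mul_of_nonneg_right (hR k) hV0pos.le
    linear_combination hA + hB

/-- Peels the first term off the geometric series `∑ i, z ^ (i + 1) * θ ^ (k + 1 + i)`, which weighs
the resets after a long agreement. -/
lemma geom_tail_rec {θ z : ℝ} (hzθ : z * θ < 1) (k : ℕ) :
    z * θ ^ (k + 1) + z * (z * θ ^ (k + 2) / (1 - z * θ)) = z * θ ^ (k + 1) / (1 - z * θ) := by
  have : 1 - z * θ ≠ 0 := by linarith
  field_simp
  ring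

/-- A supersolution of the reset equation, obtained by truncating at time `N`. -/
lemma exists_reset_bound {θ z Kp : ℝ} (hθ : θ ∈ Set.Ioo (0 : ℝ) 1) (hz : 1 < z)
    (hzθ : z * θ < 1) (hKp : 0 ≤ Kp) (N : ℕ) :
    ∃ R : ℕ → ℝ, (∀ k, 0 ≤ R k) ∧
      R 0 ≤ z ^ N * (1 - Real.exp (-(Kp * (1 - θ)⁻¹)))
        + Kp * (z * θ) ^ (N + 1) / (1 - z * θ) ∧
      ∀ k, z * ((1 - Real.exp (-(Kp * θ ^ (k + 1))))
        + Real.exp (-(Kp * θ ^ (k + 1))) * R (k + 1)) ≤ R k := by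
  have h1 : 0 < 1 - z * θ := by linarith
  have hz0 : 0 < z := by linarith
  have hqle : ∀ k, 1 - Real.exp (-(Kp * θ ^ (k + 1))) ≤ Kp * θ ^ (k + 1) := fun k => by
    linarith [Real.add_one_le_exp (-(Kp * θ ^ (k + 1)))]
  have hq1 : ∀ k, Real.exp (-(Kp * θ ^ (k + 1))) ≤ 1 := fun k => by
    rw [Real.exp_le_one_iff]
    linarith [mul_nonneg hKp (pow_nonneg hθ.1.le (k + 1))]
  set s : ℕ → ℝ := fun k => ∑ j ∈ Finset.Ico k N, θ ^ (j + 1) with hs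
  set T : ℕ → ℝ := fun k => Kp * (z * θ ^ (k + 1) / (1 - z * θ)) with hT
  have hs0 : ∀ k, 0 ≤ s k := fun k => Finset.sum_nonneg fun j _ => pow_nonneg hθ.1.le _
  have hT0 : ∀ k, 0 ≤ T k := fun k =>
    mul_nonneg hKp (div_nonneg (mul_nonneg hz0.le (pow_nonneg hθ.1.le _)) h1.le)
  -- Below `N`, every reset is charged the full weight `z ^ (N - k)` and `exp (-(Kp * s k))` is the
  -- exact probability of reaching `N` without one. From `N` on, the union bound `1 - q k ≤ Kp * θ ^
  -- (k + 1)` gives the tail `T`.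
  refine ⟨fun k => if k < N then z ^ (N - k) * (1 - Real.exp (-(Kp * s k)) + T N) else T k,
    ?_, ?_, ?_⟩
  · intro k
    dsimp only
    split_ifs
    · refine mul_nonneg (pow_nonneg hz0.le _) (add_nonneg (sub_nonneg.2 ?_) (hT0 N))
      rw [Real.exp_le_one_iff]
      linarith [mul_nonneg hKp (hs0 k)]
    · exact hT0 k
  · have hsle : s 0 ≤ (1 - θ)⁻¹ := by
      rw [hs, ← tsum_geometric_of_lt_one hθ.1.le hθ.2]
      simp only [Nat.Ico_zero_eq_range]
      calc ∑ j ∈ Finset.range N, θ ^ (j + 1) ≤ ∑ j ∈ Finset.range N, θ ^ j :=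
            Finset.sum_le_sum fun j _ => pow_le_pow_of_le_one hθ.1.le hθ.2.le (Nat.le_succ j)
        _ ≤ _ := (summable_geometric_of_lt_one hθ.1.le hθ.2).sum_le_tsum _
            fun j _ => pow_nonneg hθ.1.le j
    have e : z ^ N * T N = Kp * (z * θ) ^ (N + 1) / (1 - z * θ) := by
      rw [hT, mul_pow, pow_succ z]; ring
    have ha : (1 - Real.exp (-(Kp * s 0))) ≤ 1 - Real.exp (-(Kp * (1 - θ)⁻¹)) := by
      have := mul_le_mul_of_nonneg_left hsle hKp
      have := Real.exp_le_exp.2 (neg_le_neg this)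
      linarith
    dsimp only
    split_ifs with hN
    · rw [← e, Nat.sub_zero, mul_add]
      have := mul_le_mul_of_nonneg_left ha (pow_nonneg hz0.le N)
      linarith
    · obtain rfl : N = 0 := by omega
      rw [← e]
      have : Real.exp (-(Kp * (1 - θ)⁻¹)) ≤ 1 := by
        rw [Real.exp_le_one_iff]
        linarith [mul_nonneg hKp (inv_nonneg.2 (sub_nonneg.2 hθ.2.le))]
      simp only [pow_zero, one_mul]
      linarith
  · intro k
    dsimp only
    have hq0 := Real.exp_pos (-(Kp * θ ^ (k + 1)))
    rcases lt_trichotomy (k + 1) N with hk | hk | hk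
    · rw [if_pos hk, if_pos (by omega)]
      obtain ⟨m, rfl⟩ : ∃ m, N = k + 1 + m := ⟨N - (k + 1), by omega⟩
      have es : s k = θ ^ (k + 1) + s (k + 1) := by
        simp only [hs]
        rw [Finset.sum_eq_sum_Ico_succ_bot (by omega)]
      -- The survival probability factors over the next step.
      have ee : Real.exp (-(Kp * s k))
          = Real.exp (-(Kp * θ ^ (k + 1))) * Real.exp (-(Kp * s (k + 1))) := by
        rw [← Real.exp_add, es]; congr 1; ring
      rw [ee, show k + 1 + m - (k + 1) = m by omega, show k + 1 + m - k = m + 1 by omega]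
      have hzm : 1 ≤ z ^ m := one_le_pow₀ hz.le
      have hTN := hT0 (k + 1 + m)
      set q := Real.exp (-(Kp * θ ^ (k + 1)))
      have h3 : (1 - q) ≤ z ^ m * (1 - q) :=
        le_mul_of_one_le_left (sub_nonneg.2 (hq1 k)) hzm
      have h4 : z ^ m * (q * T (k + 1 + m)) ≤ z ^ m * T (k + 1 + m) :=
        mul_le_mul_of_nonneg_left (mul_le_of_le_one_left hTN (hq1 k)) (by positivity)
      have h5 := mul_le_mul_of_nonneg_left (add_le_add h3 h4) hz0.le
      rw [pow_succ]
      linear_combination h5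
    · subst hk
      rw [if_neg (by omega), if_pos (by omega)]
      have es : s k = θ ^ (k + 1) := by simp [hs]
      rw [es, show k + 1 - k = 1 by omega, pow_one]
      exact mul_le_mul_of_nonneg_left
        (add_le_add le_rfl (mul_le_of_le_one_left (hT0 _) (hq1 k))) hz0.le
    · rw [if_neg (by omega), if_neg (by omega)]
      have h3 := mul_le_of_le_one_left (hT0 (k + 1)) (hq1 k)
      have h4 := mul_le_mul_of_nonneg_left (add_le_add (hqle k) h3) hz0.le
      refine h4.trans (le_of_eq ?_)
      simp only [hT]
      rw [← geom_tail_rec hzθ k]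
      ring

/-- The numerical content of the choice of `z₀`. -/
lemma reset_parameters {θ Kp a ε U z₀ : ℝ} (hθ : θ ∈ Set.Ioo (0 : ℝ) 1) (hKp : 1 ≤ Kp)
    (ha : a = 1 - Real.exp (-(Kp * (1 - θ)⁻¹)))
    (hε : ε ∈ Set.Ioo 0 (min (1 - a) (1 - θ)))
    (hU : U = Real.log (1 - ε) / (Real.log (θ * ε * (1 - ε - θ)) - Real.log (2 * Kp)))
    (hz₀ : z₀ ∈ Set.Ioo 1
      (min (((a + ε / 2) / a) ^ U)
        (min ((θ + ε) / θ) (min ((1 - ε) / θ) (Real.exp 2))))) :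
    1 < √z₀ ∧ √z₀ * θ < 1 ∧ Real.log √z₀ ≤ 1 - √z₀ * θ ∧
      ∃ N : ℕ, √z₀ ^ N * a + Kp * (√z₀ * θ) ^ (N + 1) / (1 - √z₀ * θ) ≤ a + ε := by
  obtain ⟨hε0, hε'⟩ := hε
  obtain ⟨hεa, hεθ⟩ := lt_min_iff.1 hε'
  obtain ⟨hz1, hz'⟩ := hz₀
  obtain ⟨hzU, hz'⟩ := lt_min_iff.1 hz'
  obtain ⟨hzθ1, hz'⟩ := lt_min_iff.1 hz'
  obtain ⟨hzθ2, -⟩ := lt_min_iff.1 hz'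
  obtain ⟨hθ0, hθ1⟩ := hθ
  rw [lt_div_iff₀ hθ0] at hzθ1 hzθ2
  have ha2 : 1 / 2 ≤ a := by
    have h1 : 1 ≤ Kp * (1 - θ)⁻¹ := by
      have : 1 ≤ (1 - θ)⁻¹ := (one_le_inv₀ (by linarith)).2 (by linarith)
      exact one_le_mul_of_one_le_of_one_le hKp this
    have h2 : Real.exp (-(Kp * (1 - θ)⁻¹)) ≤ Real.exp (-1) := Real.exp_le_exp.2 (by linarith)
    have h3 : Real.exp (-1) ≤ 1 / 2 := by
      rw [Real.exp_neg, one_div]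
      exact inv_anti₀ (by norm_num) (by linarith [Real.add_one_le_exp 1])
    linarith
  have ha0 : 0 < a := by linarith
  set z := √z₀ with hz
  have hz1' : 1 < z := Real.lt_sqrt_of_sq_lt (by simpa using hz1)
  have hzsq : z * z = z₀ := Real.mul_self_sqrt (by linarith)
  have hz0 : 0 < z := by linarith
  have hzz : z ≤ z₀ := by
    rw [← hzsq]
    exact le_mul_of_one_le_left hz0.le hz1'.le
  have hzθle : z * θ ≤ z₀ * θ := mul_le_mul_of_nonneg_right hzz hθ0.le
  set b := θ * ε * (1 - ε - θ) with hb
  have hb0 : 0 < b := mul_pos (mul_pos hθ0 hε0) (by linarith)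
  have hb1 : b ≤ 1 := by
    have h1 : θ * ε ≤ 1 := mul_le_one₀ hθ1.le hε0.le (by linarith)
    exact mul_le_one₀ h1 (by linarith) (by linarith)
  set D := Real.log (2 * Kp) - Real.log b with hD
  have hlog2K : 0 < Real.log (2 * Kp) := Real.log_pos (by linarith)
  have hlogb : Real.log b ≤ 0 := Real.log_nonpos hb0.le hb1
  have hD0 : 0 < D := by linarith
  have hUD : U * D = -Real.log (1 - ε) := by
    rw [hU, ← neg_sub (Real.log (2 * Kp)), ← hD, div_neg, neg_mul, div_mul_cancel₀ _ hD0.ne']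
  have hlogε : Real.log (1 - ε) < 0 := Real.log_neg (by linarith) (by linarith)
  have hUeq : U = -Real.log (1 - ε) / D := eq_div_of_mul_eq hD0.ne' hUD
  have hU0 : 0 < U := by rw [hUeq]; exact div_pos (by linarith) hD0
  -- Equivalent to `b ≤ 2 * Kp * (1 - ε)`, which holds because `1 - ε > a ≥ 1 / 2` and `b ≤ 1`.
  have hU1 : U ≤ 1 := by
    rw [hUeq, div_le_one hD0, hD, ← Real.log_inv, ← Real.log_div (by positivity) hb0.ne']
    apply Real.log_le_log (inv_pos.2 (by linarith))
    rw [inv_le_comm₀ (by linarith) (by positivity), inv_div, div_le_iff₀ (by linarith)]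
    have : 1 / 2 * 1 ≤ (1 - ε) * Kp :=
      mul_le_mul (by linarith) hKp zero_le_one (by linarith)
    linarith
  have hc : 1 < (a + ε / 2) / a := by rw [lt_div_iff₀ ha0]; linarith
  refine ⟨hz1', by linarith, ?_, ?_⟩
  · have h1 : Real.log z ≤ U * Real.log ((a + ε / 2) / a) := by
      rw [← Real.log_rpow (by linarith)]
      exact Real.log_le_log hz0 (hzz.trans hzU.le)
    have h2 : Real.log ((a + ε / 2) / a) ≤ ε := by
      refine (Real.log_le_sub_one_of_pos (by linarith)).trans ?_
      rw [sub_le_iff_le_add, div_le_iff₀ ha0]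
      linarith [mul_le_mul_of_nonneg_left ha2 hε0.le]
    have h3 := mul_le_mul hU1 h2 (Real.log_pos hc).le zero_le_one
    linarith
  -- `N ≤ 1 / U` keeps `z ^ N * a` below `a + ε / 2`, while `N + 1 ≥ 1 / U` makes the tail at most
  -- `ε / 2`: `U` is defined so that `(1 - ε) ^ (1 / U) = b / (2 * Kp)`.
  · refine ⟨⌊U⁻¹⌋₊, ?_⟩
    set N := ⌊U⁻¹⌋₊
    have hNle : (N : ℝ) ≤ U⁻¹ := Nat.floor_le (inv_nonneg.2 hU0.le)
    have hltN : U⁻¹ ≤ (N + 1 : ℕ) := by push_cast; exact (Nat.lt_floor_add_one _).le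
    have h1 : z ^ N ≤ (a + ε / 2) / a := by
      rw [← Real.rpow_natCast]
      calc z ^ (N : ℝ) ≤ z ^ U⁻¹ := Real.rpow_le_rpow_of_exponent_le hz1'.le hNle
        _ ≤ (((a + ε / 2) / a) ^ U) ^ U⁻¹ :=
            Real.rpow_le_rpow hz0.le (hzz.trans hzU.le) (inv_nonneg.2 hU0.le)
        _ = _ := by rw [← Real.rpow_mul (by linarith), mul_inv_cancel₀ hU0.ne', Real.rpow_one]
    have hzθ0 : 0 < z * θ := mul_pos hz0 hθ0
    have h2 : (z * θ) ^ (N + 1) ≤ b / (2 * Kp) := by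
      calc (z * θ) ^ (N + 1) ≤ (1 - ε) ^ (N + 1) :=
            pow_le_pow_left₀ hzθ0.le (by linarith) _
        _ = (1 - ε) ^ ((N + 1 : ℕ) : ℝ) := (Real.rpow_natCast _ _).symm
        _ ≤ (1 - ε) ^ U⁻¹ :=
            Real.rpow_le_rpow_of_exponent_ge (by linarith) (by linarith) hltN
        _ = b / (2 * Kp) := by
            rw [Real.rpow_def_of_pos (by linarith), ← Real.exp_log (div_pos hb0 (by linarith)),
              Real.log_div hb0.ne' (by positivity)]
            congr 1
            rw [← div_eq_mul_inv, div_eq_iff hU0.ne']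
            linarith
    have h3 : z ^ N * a ≤ a + ε / 2 := by rwa [← le_div_iff₀ ha0]
    have h4 : Kp * (z * θ) ^ (N + 1) / (1 - z * θ) ≤ ε / 2 := by
      rw [div_le_iff₀ (by linarith)]
      have h5 : Kp * (z * θ) ^ (N + 1) ≤ b / 2 := by
        refine (mul_le_mul_of_nonneg_left h2 (by linarith)).trans (le_of_eq ?_)
        field_simp
      have h6 : θ * (ε * (1 - ε - θ)) ≤ 1 * (ε * (1 - ε - θ)) :=
        mul_le_mul_of_nonneg_right hθ1.le (mul_nonneg hε0.le (by linarith))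
      have h7 : ε * (1 - ε - θ) ≤ ε * (1 - z * θ) :=
        mul_le_mul_of_nonneg_left (by linarith) hε0.le
      rw [hb] at h5
      linarith
    linarith

end Lyapunov

/-- Decay of the oscillation of `P ^ n φ` at the rate `√z₀`. -/
lemma abs_iterate_transferOp_sub_le_of_params {S : Type*} [Fintype S]
    {θ : ℝ} (hθ : θ ∈ Set.Ioo (0 : ℝ) 1)
    {φp : (ℕ → S) → ℝ} {Kp : ℝ} (hφp : IsLipBound θ φp Kp) (hnorm : IsNormalized φp)
    {φ : (ℕ → S) → ℝ} {K : ℝ} (hφ : IsLipBound θ φ K) {a ε U z₀ : ℝ}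
    (ha : a = 1 - Real.exp (-(Kp * (1 - θ)⁻¹)))
    (hε : ε ∈ Set.Ioo 0 (min (1 - a) (1 - θ)))
    (hU : U = Real.log (1 - ε) / (Real.log (θ * ε * (1 - ε - θ)) - Real.log (2 * Kp)))
    (hz₀ : z₀ ∈ Set.Ioo 1
      (min (((a + ε / 2) / a) ^ U)
        (min ((θ + ε) / θ) (min ((1 - ε) / θ) (Real.exp 2)))))
    (n : ℕ) (x y : ℕ → S) :
    |(transferOp φp)^[n] φ x - (transferOp φp)^[n] φ y| ≤
      (√z₀ ^ n)⁻¹ / (Real.log √z₀ * (1 - a - ε)) * K := by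
  have hKp := hφp.one_le
  obtain ⟨hz, hzθ, hlog, N, hN⟩ := reset_parameters hθ hKp ha hε hU hz₀
  have hεa : ε < 1 - a := (lt_min_iff.1 hε.2).1
  obtain ⟨R, hR0, hRr, hR⟩ := exists_reset_bound hθ hz hzθ (zero_le_one.trans hKp) N
  rw [← ha] at hRr
  obtain ⟨V, hV0, hVθ, hV⟩ := exists_lyapunov_of_reset hθ hz hzθ
    (q := fun k => Real.exp (-(Kp * θ ^ (k + 1))))
    (fun k => Real.exp_le_one_iff.2 (neg_nonpos.2
      (mul_nonneg (zero_le_one.trans hKp) (pow_nonneg hθ.1.le _))))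
    hR0 (hRr.trans hN) (by linarith) hR
  have hlog0 : 0 < Real.log √z₀ := Real.log_pos hz
  have hz0 : 0 < √z₀ := by linarith
  -- Here `1 - √z₀ * θ` is weakened to the smaller `log √z₀` of the stated bound.
  have hV0' : V 0 ≤ (Real.log √z₀ * (1 - a - ε))⁻¹ := by
    refine hV0.trans (inv_anti₀ (mul_pos hlog0 (by linarith)) ?_)
    rw [← sub_sub]
    exact mul_le_mul_of_nonneg_right hlog (by linarith)
  refine (abs_iterate_transferOp_sub_le hθ hφp hnorm hφ hz0 hVθ hV n 0 x y (by simp)).trans ?_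
  have hK : 0 ≤ K * (√z₀ ^ n)⁻¹ :=
    mul_nonneg (zero_le_one.trans hφ.one_le) (inv_nonneg.2 (pow_nonneg hz0.le n))
  refine (mul_le_mul_of_nonneg_left hV0' hK).trans (le_of_eq ?_)
  rw [div_eq_mul_inv]
  ring

/-- `f` is Lipschitz for `symbDist θ`, with an unspecified constant. -/
def HasLip {S : Type*} (θ : ℝ) (f : (ℕ → S) → ℝ) : Prop :=
  ∃ L : ℝ, 0 ≤ L ∧ ∀ (k : ℕ) (x y : ℕ → S), (∀ i < k, x i = y i) → |f x - f y| ≤ L * θ ^ k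

/-! ### Stability of Lipschitz regularity, constants immaterial. -/

section HasLip

variable {S : Type*} {θ : ℝ} {f g φp : (ℕ → S) → ℝ}

lemma IsLipBound.hasLip (hθ : θ ∈ Set.Ioo (0 : ℝ) 1) {K : ℝ} (h : IsLipBound θ f K) :
    HasLip θ f :=
  have hK := zero_le_one.trans h.one_le
  ⟨K, hK, fun _ x y hxy =>
    (h.lipschitz x y).trans (mul_le_mul_of_nonneg_left (symbDist_le_pow hθ hxy) hK)⟩

lemma HasLip.exists_abs_le (hf : HasLip θ f) : ∃ M, 0 ≤ M ∧ ∀ x, |f x| ≤ M := by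
  obtain ⟨L, hL, h⟩ := hf
  rcases isEmpty_or_nonempty (ℕ → S) with hS | ⟨⟨x₀⟩⟩
  · exact ⟨0, le_rfl, fun x => (hS.false x).elim⟩
  · refine ⟨|f x₀| + L, by positivity, fun x => ?_⟩
    have h1 := h 0 x x₀ (by simp)
    have h2 := abs_sub_abs_le_abs_sub (f x) (f x₀)
    rw [pow_zero, mul_one] at h1
    linarith

lemma HasLip.add (hf : HasLip θ f) (hg : HasLip θ g) : HasLip θ fun x => f x + g x := by
  obtain ⟨L, hL, h⟩ := hf
  obtain ⟨M, hM, h'⟩ := hg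
  refine ⟨L + M, add_nonneg hL hM, fun k x y hxy => ?_⟩
  rw [add_sub_add_comm, add_mul]
  exact (abs_add_le _ _).trans (add_le_add (h k x y hxy) (h' k x y hxy))

lemma HasLip.const_mul (hf : HasLip θ f) (c : ℝ) : HasLip θ fun x => c * f x := by
  obtain ⟨L, hL, h⟩ := hf
  refine ⟨|c| * L, mul_nonneg (abs_nonneg c) hL, fun k x y hxy => ?_⟩
  rw [← mul_sub, abs_mul, mul_assoc]
  exact mul_le_mul_of_nonneg_left (h k x y hxy) (abs_nonneg c)

lemma HasLip.const (c : ℝ) : HasLip θ fun _ : ℕ → S => c :=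
  ⟨0, le_rfl, fun k x y _ => by simp⟩

lemma HasLip.mul (hθ : 0 ≤ θ) (hf : HasLip θ f) (hg : HasLip θ g) :
    HasLip θ fun x => f x * g x := by
  obtain ⟨A, hA, hfA⟩ := hf.exists_abs_le
  obtain ⟨B, hB, hgB⟩ := hg.exists_abs_le
  obtain ⟨L, hL, h⟩ := hf
  obtain ⟨M, hM, h'⟩ := hg
  refine ⟨A * M + L * B, by positivity, fun k x y hxy => ?_⟩
  have e : f x * g x - f y * g y = f x * (g x - g y) + (f x - f y) * g y := by ring
  rw [e, add_mul]
  refine (abs_add_le _ _).trans (add_le_add ?_ ?_)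
  · rw [abs_mul, mul_assoc]
    exact mul_le_mul (hfA x) (h' k x y hxy) (abs_nonneg _) hA
  · rw [abs_mul, mul_right_comm]
    exact mul_le_mul (h k x y hxy) (hgB y) (abs_nonneg _) (mul_nonneg hL (pow_nonneg hθ k))

/-- Composition with a function which is Lipschitz on the range. -/
lemma HasLip.comp (hf : HasLip θ f) {u : ℝ → ℝ} {C : ℝ} (hC : 0 ≤ C)
    (hu : ∀ x y, |u (f x) - u (f y)| ≤ C * |f x - f y|) : HasLip θ fun x => u (f x) := by
  obtain ⟨L, hL, h⟩ := hf
  refine ⟨C * L, mul_nonneg hC hL, fun k x y hxy => (hu x y).trans ?_⟩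
  rw [mul_assoc]
  exact mul_le_mul_of_nonneg_left (h k x y hxy) hC

lemma abs_log_sub_log_le {a b c : ℝ} (hc : 0 < c) (ha : c ≤ a) (hb : c ≤ b) :
    |Real.log a - Real.log b| ≤ c⁻¹ * |a - b| := by
  have key : ∀ {a b : ℝ}, c ≤ a → c ≤ b → Real.log a - Real.log b ≤ c⁻¹ * |a - b| := by
    intro a b ha hb
    have hb0 := hc.trans_le hb
    have ha0 := hc.trans_le ha
    rw [← Real.log_div ha0.ne' hb0.ne']
    refine (Real.log_le_sub_one_of_pos (div_pos ha0 hb0)).trans ?_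
    rw [div_sub_one hb0.ne', div_eq_inv_mul]
    exact (mul_le_mul_of_nonneg_left (le_abs_self _) (inv_nonneg.2 hb0.le)).trans
      (mul_le_mul_of_nonneg_right (inv_anti₀ hc hb) (abs_nonneg _))
  rw [abs_le]
  have h1 := key ha hb
  have h2 := key hb ha
  rw [abs_sub_comm] at h2
  constructor <;> linarith

lemma abs_exp_sub_exp_le {a b M : ℝ} (ha : a ≤ M) (hb : b ≤ M) :
    |Real.exp a - Real.exp b| ≤ Real.exp M * |a - b| := by
  have key : ∀ {a b : ℝ}, a ≤ M → b ≤ M →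
      Real.exp a - Real.exp b ≤ Real.exp M * |a - b| := by
    intro a b ha hb
    have h1 : Real.exp a - Real.exp b = Real.exp a * (1 - Real.exp (b - a)) := by
      rw [mul_sub, ← Real.exp_add]; simp
    rw [h1]
    refine (mul_le_mul_of_nonneg_left (?_ : _ ≤ |a - b|) (Real.exp_pos a).le).trans
      (mul_le_mul_of_nonneg_right (Real.exp_le_exp.2 ha) (abs_nonneg _))
    linarith [Real.add_one_le_exp (b - a), le_abs_self (a - b)]
  rw [abs_le]
  have h1 := key ha hb
  have h2 := key hb ha
  rw [abs_sub_comm] at h2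
  constructor <;> linarith

lemma HasLip.exp (hf : HasLip θ f) : HasLip θ fun x => Real.exp (f x) := by
  obtain ⟨M, -, hM⟩ := hf.exists_abs_le
  exact hf.comp (Real.exp_pos M).le fun x y =>
    abs_exp_sub_exp_le (le_of_abs_le (hM x)) (le_of_abs_le (hM y))

lemma HasLip.comp_prepend (hθ : θ ∈ Set.Ioo (0 : ℝ) 1) (hf : HasLip θ f) (s : S) :
    HasLip θ fun x => f (prepend s x) := by
  obtain ⟨L, hL, h⟩ := hf
  refine ⟨L, hL, fun k x y hxy => (h (k + 1) _ _ (prepend_agree hxy s)).trans ?_⟩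
  exact mul_le_mul_of_nonneg_left (pow_le_pow_of_le_one hθ.1.le hθ.2.le (Nat.le_succ k)) hL

lemma HasLip.comp_leftShift (hθ : θ ∈ Set.Ioo (0 : ℝ) 1) (hf : HasLip θ f) :
    HasLip θ fun x => f (leftShift x) := by
  obtain ⟨L, hL, h⟩ := hf
  refine ⟨L / θ, div_nonneg hL hθ.1.le, fun k x y hxy => ?_⟩
  -- The shift loses one agreeing symbol, at the price of a factor `1 / θ`. At `k = 0` truncated
  -- subtraction is harmless, as `k ≤ k - 1 + 1` still holds.
  refine (h (k - 1) _ _ fun i hi => hxy (i + 1) (by omega)).trans ?_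
  rw [div_mul_eq_mul_div, mul_div_assoc]
  refine mul_le_mul_of_nonneg_left ?_ hL
  rw [le_div_iff₀ hθ.1, ← pow_succ]
  exact pow_le_pow_of_le_one hθ.1.le hθ.2.le (by omega)

lemma HasLip.sum {ι : Type*} (s : Finset ι) {F : ι → (ℕ → S) → ℝ}
    (hF : ∀ i ∈ s, HasLip θ (F i)) : HasLip θ fun x => ∑ i ∈ s, F i x := by
  classical
  induction s using Finset.induction_on with
  | empty => simpa using HasLip.const 0
  | insert i s his ih =>
    simp only [Finset.sum_insert his]
    exact (hF i (by simp)).add (ih fun j hj => hF j (by simp [hj]))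

lemma HasLip.transferOp [Fintype S] (hθ : θ ∈ Set.Ioo (0 : ℝ) 1) (hφp : HasLip θ φp)
    (hf : HasLip θ f) : HasLip θ (transferOp φp f) :=
  HasLip.sum _ fun s _ =>
    ((hφp.comp_prepend hθ s).exp).mul hθ.1.le (hf.comp_prepend hθ s)

lemma HasLip.continuous [TopologicalSpace S] [DiscreteTopology S]
    (hθ : θ ∈ Set.Ioo (0 : ℝ) 1) (hf : HasLip θ f) : Continuous f := by
  obtain ⟨L, hL, h⟩ := hf
  rw [continuous_iff_continuousAt]
  intro x
  rw [ContinuousAt, Metric.tendsto_nhds]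
  intro ε hε
  obtain ⟨k, hk⟩ : ∃ k : ℕ, L * θ ^ k < ε := by
    have := (tendsto_pow_atTop_nhds_zero_of_lt_one hθ.1.le hθ.2).const_mul L
    rw [mul_zero] at this
    exact (this.eventually (gt_mem_nhds hε)).exists
  have : ∀ᶠ y in nhds x, ∀ i ∈ Finset.range k, y i = x i := by
    rw [Filter.eventually_all_finset]
    intro i _
    exact (continuous_apply i).continuousAt.eventually
      ((isOpen_discrete {x i}).mem_nhds (Set.mem_singleton _))
  filter_upwards [this] with y hy
  rw [Real.dist_eq]
  exact (h k y x fun i hi => hy i (Finset.mem_range.2 hi)).trans_lt hk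

end HasLip

/-! ### Continuity of the shift and of the transfer operator. -/

section Topology

variable {S : Type*} [TopologicalSpace S]

lemma continuous_leftShift : Continuous (leftShift : (ℕ → S) → ℕ → S) :=
  continuous_pi fun n => continuous_apply (n + 1)

lemma continuous_prepend (s : S) : Continuous (prepend s) := by
  refine continuous_pi fun n => ?_
  cases n with
  | zero => exact continuous_const
  | succ n => exact continuous_apply n

variable [Fintype S]

lemma continuous_transferOp {φp f : (ℕ → S) → ℝ} (hφp : Continuous φp) (hf : Continuous f) :
    Continuous (transferOp φp f) :=
  continuous_finsetSum _ fun s _ =>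
    (Real.continuous_exp.comp (hφp.comp (continuous_prepend s))).mul
      (hf.comp (continuous_prepend s))

end Topology

/-! ### The transfer operator as a Markov operator. -/

section TransferAlgebra

variable {S : Type*} [Fintype S] {φp : (ℕ → S) → ℝ}

lemma transferOp_add (f g : (ℕ → S) → ℝ) :
    transferOp φp (f + g) = transferOp φp f + transferOp φp g := by
  funext x
  simp [transferOp, mul_add, Finset.sum_add_distrib]

lemma transferOp_smul (c : ℝ) (f : (ℕ → S) → ℝ) :
    transferOp φp (c • f) = c • transferOp φp f := by
  funext x
  simp only [transferOp, Pi.smul_apply, smul_eq_mul, Finset.mul_sum]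
  exact Finset.sum_congr rfl fun s _ => by ring

lemma transferOp_nonneg {f : (ℕ → S) → ℝ} (hf : 0 ≤ f) : 0 ≤ transferOp φp f :=
  fun _ => Finset.sum_nonneg fun _ _ => mul_nonneg (Real.exp_pos _).le (hf _)

lemma transferOp_const (h : IsNormalized φp) (c : ℝ) :
    transferOp φp (fun _ => c) = fun _ => c := by
  funext x
  rw [transferOp, ← Finset.sum_mul, h x, one_mul]

/-- `f ∘ σ` is constant on the points `s x` over which `P` averages. This puts `f - (P f) ∘ σ` in
the kernel of `P` and makes fixed measures of the dual shift-invariant. -/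
lemma transferOp_comp_leftShift (h : IsNormalized φp) (f : (ℕ → S) → ℝ) :
    transferOp φp (fun x => f (leftShift x)) = f := by
  funext x
  simp only [transferOp, leftShift_prepend]
  rw [← Finset.sum_mul, h x, one_mul]

lemma iterate_transferOp_add (f g : (ℕ → S) → ℝ) (n : ℕ) :
    (transferOp φp)^[n] (f + g) = (transferOp φp)^[n] f + (transferOp φp)^[n] g := by
  induction n with
  | zero => rfl
  | succ n ih => simp only [Function.iterate_succ_apply', ih, transferOp_add]

lemma iterate_transferOp_smul (c : ℝ) (f : (ℕ → S) → ℝ) (n : ℕ) :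
    (transferOp φp)^[n] (c • f) = c • (transferOp φp)^[n] f := by
  induction n with
  | zero => rfl
  | succ n ih => simp only [Function.iterate_succ_apply', ih, transferOp_smul]

lemma iterate_transferOp_nonneg {f : (ℕ → S) → ℝ} (hf : 0 ≤ f) (n : ℕ) :
    0 ≤ (transferOp φp)^[n] f := by
  induction n with
  | zero => exact hf
  | succ n ih => rw [Function.iterate_succ_apply']; exact transferOp_nonneg ih

lemma iterate_transferOp_const (h : IsNormalized φp) (c : ℝ) (n : ℕ) :
    (transferOp φp)^[n] (fun _ => c) = fun _ => c := by
  induction n with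
  | zero => rfl
  | succ n ih => rw [Function.iterate_succ_apply', ih, transferOp_const h]

lemma iterate_transferOp_mono {f g : (ℕ → S) → ℝ} (hfg : f ≤ g) (n : ℕ) :
    (transferOp φp)^[n] f ≤ (transferOp φp)^[n] g := by
  have h := iterate_transferOp_nonneg (φp := φp) (sub_nonneg.2 hfg) n
  have e := iterate_transferOp_add (φp := φp) (g - f) f n
  rw [sub_add_cancel] at e
  rw [e]
  exact le_add_of_nonneg_left h

lemma abs_iterate_transferOp_le (h : IsNormalized φp) {f : (ℕ → S) → ℝ} {M : ℝ}
    (hM : ∀ x, |f x| ≤ M) (n : ℕ) (x : ℕ → S) : |(transferOp φp)^[n] f x| ≤ M := by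
  have h1 := iterate_transferOp_mono (φp := φp) (f := f) (g := fun _ => M)
    (fun x => le_of_abs_le (hM x)) n x
  have h2 := iterate_transferOp_mono (φp := φp) (f := fun _ => -M) (g := f)
    (fun x => neg_le_of_abs_le (hM x)) n x
  rw [iterate_transferOp_const h] at h1 h2
  exact abs_le.2 ⟨h2, h1⟩

end TransferAlgebra

/-! ### Iterates as sums over words; bounded distortion. -/

section Words

variable {S : Type*}

/-- The sequence `w x` obtained by putting the word `w` in front of `x`. -/
def wordAppend : (n : ℕ) → (Fin n → S) → (ℕ → S) → ℕ → S
  | 0, _, x => x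
  | n + 1, w, x => prepend (w 0) (wordAppend n (Fin.tail w) x)

lemma wordAppend_apply (x : ℕ → S) : ∀ (n : ℕ) (w : Fin n → S) (i : Fin n),
    wordAppend n w x i = w i := by
  intro n
  induction n with
  | zero => exact fun _ i => i.elim0
  | succ n ih =>
    intro w i
    cases i using Fin.cases with
    | zero => rfl
    | succ i => exact ih (Fin.tail w) i

lemma wordAppend_cons (n : ℕ) (s : S) (w : Fin n → S) (x : ℕ → S) :
    wordAppend (n + 1) (Fin.cons s w) x = prepend s (wordAppend n w x) := rfl

lemma iterate_transferOp_eq_sum_words [Fintype S] (φp : (ℕ → S) → ℝ) (n : ℕ) :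
    ∀ (f : (ℕ → S) → ℝ) (x : ℕ → S), (transferOp φp)^[n] f x
      = ∑ w : Fin n → S, Real.exp (birkhoffSum leftShift φp n (wordAppend n w x))
          * f (wordAppend n w x) := by
  induction n with
  | zero => intro f x; simp [wordAppend]
  | succ n ih =>
    intro f x
    -- The innermost `P` adds its symbol in front of the word, so words of length `n + 1` are split
    -- at their first letter.
    rw [Function.iterate_succ_apply, ih,
      ← (Fin.consEquiv fun _ : Fin (n + 1) => S).sum_comp, Fintype.sum_prod_type_right]
    refine Finset.sum_congr rfl fun w _ => ?_
    rw [transferOp, Finset.mul_sum]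
    refine Finset.sum_congr rfl fun s _ => ?_
    change _ = Real.exp (birkhoffSum leftShift φp (n + 1) (wordAppend (n + 1) (Fin.cons s w) x))
      * f (wordAppend (n + 1) (Fin.cons s w) x)
    rw [wordAppend_cons, birkhoffSum_succ', leftShift_prepend, Real.exp_add]
    ring

lemma abs_birkhoffSum_sub_le {θ L : ℝ} (hθ : θ ∈ Set.Ioo (0 : ℝ) 1) {ψ : (ℕ → S) → ℝ}
    (hL : 0 ≤ L)
    (h : ∀ (k : ℕ) (x y : ℕ → S), (∀ i < k, x i = y i) → |ψ x - ψ y| ≤ L * θ ^ k) (n : ℕ) :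
    ∀ x y : ℕ → S, (∀ i < n, x i = y i) →
      |birkhoffSum leftShift ψ n x - birkhoffSum leftShift ψ n y| ≤ L * (1 - θ)⁻¹ := by
  -- The factor `1 - θ ^ n`, a partial geometric sum, lets the induction close.
  have key : ∀ x y : ℕ → S, (∀ i < n, x i = y i) →
      |birkhoffSum leftShift ψ n x - birkhoffSum leftShift ψ n y|
        ≤ L * (1 - θ)⁻¹ * (1 - θ ^ n) := by
    have h1 : 0 < 1 - θ := by linarith [hθ.2]
    induction n with
    | zero => intro x y _; simp
    | succ n ih =>
      intro x y hxy
      rw [birkhoffSum_succ', birkhoffSum_succ', add_sub_add_comm]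
      refine (abs_add_le _ _).trans ((add_le_add (h (n + 1) x y hxy)
        (ih (leftShift x) (leftShift y) fun i hi => hxy (i + 1) (by omega))).trans ?_)
      have e : L * (1 - θ)⁻¹ * (1 - θ ^ (n + 1))
          = L * (1 - θ)⁻¹ * (1 - θ ^ n) + L * θ ^ n := by
        field_simp
        ring
      rw [e, add_comm]
      have := mul_le_mul_of_nonneg_left
        (pow_le_pow_of_le_one hθ.1.le hθ.2.le n.le_succ) hL
      rw [Nat.succ_eq_add_one] at this
      linarith
  intro x y hxy
  refine (key x y hxy).trans (mul_le_of_le_one_right ?_ ?_)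
  · exact mul_nonneg hL (inv_nonneg.2 (by linarith [hθ.2]))
  · linarith [pow_nonneg hθ.1.le n]

end Words

/-! ### Cylinders and integrals of Birkhoff sums. -/

section Integrals

variable {S : Type*}

/-- The cylinder of a word. -/
abbrev cyl {n : ℕ} (w : Fin n → S) : Set (ℕ → S) := {x | ∀ i : Fin n, x i = w i}

lemma iUnion_cyl (n : ℕ) : ⋃ w : Fin n → S, cyl w = Set.univ := by
  refine Set.eq_univ_of_forall fun x => Set.mem_iUnion.2 ⟨fun i => x i, fun i => rfl⟩

lemma pairwise_disjoint_cyl (n : ℕ) :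
    Pairwise fun w w' : Fin n → S => Disjoint (cyl w) (cyl w') := by
  intro w w' hne
  rw [Set.disjoint_left]
  intro x hx hx'
  exact hne (funext fun i => (hx i).symm.trans (hx' i))

variable [MeasurableSpace S]

lemma measurable_leftShift : Measurable (leftShift : (ℕ → S) → ℕ → S) :=
  measurable_pi_lambda _ fun n => measurable_pi_apply (n + 1)

lemma integrable_birkhoffSum {μ : Measure (ℕ → S)} (hμ : MeasurePreserving leftShift μ μ)
    {f : (ℕ → S) → ℝ} (hf : Integrable f μ) (n : ℕ) :
    Integrable (birkhoffSum leftShift f n) μ := by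
  unfold birkhoffSum
  exact integrable_finsetSum _ fun k _ => (hμ.iterate k).integrable_comp_of_integrable hf

lemma integral_comp_leftShift {μ : Measure (ℕ → S)} (hμ : MeasurePreserving leftShift μ μ)
    {f : (ℕ → S) → ℝ} (hf : Integrable f μ) : ∫ x, f (leftShift x) ∂μ = ∫ x, f x ∂μ := by
  have := integral_map (μ := μ) (f := f) hμ.measurable.aemeasurable
    (by rw [hμ.map_eq]; exact hf.aestronglyMeasurable)
  rw [hμ.map_eq] at this
  exact this.symm

lemma integral_birkhoffSum {μ : Measure (ℕ → S)} (hμ : MeasurePreserving leftShift μ μ)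
    {f : (ℕ → S) → ℝ} (hf : Integrable f μ) (n : ℕ) :
    ∫ x, birkhoffSum leftShift f n x ∂μ = n * ∫ x, f x ∂μ := by
  induction n with
  | zero => simp
  | succ n ih =>
    simp only [birkhoffSum_succ']
    have hi := integrable_birkhoffSum hμ hf n
    have hi' : Integrable (fun x => birkhoffSum leftShift f n (leftShift x)) μ :=
      hμ.integrable_comp_of_integrable hi
    rw [integral_add hf hi',
      integral_comp_leftShift hμ hi, ih]
    push_cast
    ring

variable [Fintype S] [DiscreteMeasurableSpace S]

lemma measurableSet_cyl {n : ℕ} (w : Fin n → S) :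
    MeasurableSet (cyl w) := by
  have : cyl w = ⋂ i : Fin n, (fun x : ℕ → S => x i) ⁻¹' {w i} := by
    ext x; simp [cyl]
  rw [this]
  exact MeasurableSet.iInter fun i => measurable_pi_apply (i : ℕ) (measurableSet_singleton _)

lemma sum_measureReal_cyl (μ : Measure (ℕ → S))
    [IsProbabilityMeasure μ] (n : ℕ) : ∑ w : Fin n → S, μ.real (cyl w) = 1 := by
  rw [← measureReal_iUnion_fintype (pairwise_disjoint_cyl n) measurableSet_cyl, iUnion_cyl,
    probReal_univ]

variable [TopologicalSpace S] [DiscreteTopology S]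

lemma HasLip.integrable {θ : ℝ} (hθ : θ ∈ Set.Ioo (0 : ℝ) 1) {f : (ℕ → S) → ℝ}
    (hf : HasLip θ f) (μ : Measure (ℕ → S)) [IsFiniteMeasure μ] : Integrable f μ := by
  obtain ⟨M, -, hM⟩ := hf.exists_abs_le
  exact Integrable.of_bound (hf.continuous hθ).measurable.aestronglyMeasurable M
    (Filter.Eventually.of_forall fun x => by simpa using hM x)

lemma Continuous.integrable_of_seq {f : (ℕ → S) → ℝ} (hf : Continuous f)
    (μ : Measure (ℕ → S)) [IsFiniteMeasure μ] : Integrable f μ :=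
  hf.integrable_of_hasCompactSupport (HasCompactSupport.of_compactSpace f)

end Integrals

/-! ### The two halves of the variational principle. -/

section Entropy

variable {S : Type*} [Fintype S] [MeasurableSpace S]

lemma blockEntropy_nonneg (μ : Measure (ℕ → S)) [IsProbabilityMeasure μ] (n : ℕ) :
    0 ≤ blockEntropy μ n :=
  Finset.sum_nonneg fun _ _ => Real.negMulLog_nonneg measureReal_nonneg measureReal_le_one

lemma shiftEntropy_le (μ : Measure (ℕ → S)) [IsProbabilityMeasure μ] {n : ℕ} (hn : 1 ≤ n) :
    shiftEntropy μ ≤ blockEntropy μ n / n :=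
  csInf_le ⟨0, by
    rintro _ ⟨m, -, rfl⟩
    exact div_nonneg (blockEntropy_nonneg μ m) m.cast_nonneg⟩ ⟨n, hn, rfl⟩

lemma le_shiftEntropy {μ : Measure (ℕ → S)} {h : ℝ}
    (H : ∀ n : ℕ, n * h ≤ blockEntropy μ n) : h ≤ shiftEntropy μ := by
  refine le_csInf ⟨_, 1, Set.mem_Ici.2 le_rfl, rfl⟩ ?_
  rintro _ ⟨n, hn, rfl⟩
  have : (0 : ℝ) < n := by exact_mod_cast hn
  dsimp only
  rw [le_div_iff₀ this, mul_comm]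
  exact H n

/-- Gibbs' inequality. -/
lemma negMulLog_add_mul_le {m b : ℝ} (hm : 0 ≤ m) :
    Real.negMulLog m + m * b ≤ Real.exp b - m := by
  rcases hm.eq_or_lt with rfl | hm
  · simpa using (Real.exp_pos b).le
  · have h := Real.add_one_le_exp (b - Real.log m)
    rw [Real.exp_sub, Real.exp_log hm, le_div_iff₀ hm] at h
    rw [Real.negMulLog]
    linarith

variable [DiscreteMeasurableSpace S]

/-- The variational inequality for a normalized Lipschitz potential. -/
lemma shiftEntropy_add_integral_le_zero {θ : ℝ} (hθ : θ ∈ Set.Ioo (0 : ℝ) 1)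
    {ψ : (ℕ → S) → ℝ} (hψ : HasLip θ ψ) (hnorm : IsNormalized ψ)
    {μ : Measure (ℕ → S)} [IsProbabilityMeasure μ] (hμ : MeasurePreserving leftShift μ μ) :
    shiftEntropy μ + ∫ x, ψ x ∂μ ≤ 0 := by
  let _ : TopologicalSpace S := ⊥
  have : DiscreteTopology S := ⟨rfl⟩
  have hint : Integrable ψ μ := hψ.integrable hθ μ
  obtain ⟨L, hL, h⟩ := hψ
  obtain ⟨x₀⟩ : Nonempty (ℕ → S) := nonempty_of_isProbabilityMeasure μ
  set C := L * (1 - θ)⁻¹ with hC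
  -- Distortion replaces the Birkhoff sum on each cylinder by `b w + C`; Gibbs' inequality against
  -- the probability weights `exp (b w)` leaves only `C`, which is uniform in `n`.
  have key : ∀ n : ℕ, blockEntropy μ n + n * ∫ x, ψ x ∂μ ≤ C := by
    intro n
    have hB := integrable_birkhoffSum hμ hint n
    set b : (Fin n → S) → ℝ := fun w => birkhoffSum leftShift ψ n (wordAppend n w x₀) with hb
    have h1 : ∀ w : Fin n → S, ∫ x in cyl w, birkhoffSum leftShift ψ n x ∂μ
        ≤ μ.real (cyl w) * (b w + C) := by
      intro w
      rw [← smul_eq_mul, ← setIntegral_const]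
      refine setIntegral_mono_on hB.integrableOn (integrable_const _).integrableOn
        (measurableSet_cyl w) fun x hx => ?_
      have := (abs_le.1 (abs_birkhoffSum_sub_le hθ hL h n x (wordAppend n w x₀)
        fun i hi => (hx ⟨i, hi⟩).trans (wordAppend_apply x₀ n w ⟨i, hi⟩).symm)).2
      linarith
    have h2 : n * ∫ x, ψ x ∂μ = ∑ w : Fin n → S,
        ∫ x in cyl w, birkhoffSum leftShift ψ n x ∂μ := by
      rw [← integral_birkhoffSum hμ hint n, ← setIntegral_univ, ← iUnion_cyl n]
      exact integral_iUnion_fintype measurableSet_cyl (pairwise_disjoint_cyl n)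
        fun w => hB.integrableOn
    have h3 : ∑ w, Real.exp (b w) = 1 := by
      have := iterate_transferOp_eq_sum_words ψ n (fun _ => 1) x₀
      simpa [iterate_transferOp_const hnorm] using this.symm
    have h4 := sum_measureReal_cyl μ n
    calc blockEntropy μ n + n * ∫ x, ψ x ∂μ
        ≤ ∑ w : Fin n → S, (Real.exp (b w) - μ.real (cyl w) + μ.real (cyl w) * C) := by
          rw [h2, blockEntropy, ← Finset.sum_add_distrib]
          refine Finset.sum_le_sum fun w _ => ?_
          have := negMulLog_add_mul_le (b := b w) (measureReal_nonneg (μ := μ) (s := cyl w))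
          linarith [h1 w]
      _ = C := by
          rw [Finset.sum_add_distrib, Finset.sum_sub_distrib, ← Finset.sum_mul, h3, h4]
          ring
  have key' : ∀ n : ℕ, 1 ≤ n → n * (shiftEntropy μ + ∫ x, ψ x ∂μ) ≤ C := by
    intro n hn
    have h1 := shiftEntropy_le μ hn
    rw [le_div_iff₀ (by exact_mod_cast hn)] at h1
    linarith [key n]
  by_contra! hpos
  obtain ⟨n, hn⟩ := exists_nat_gt (max 1 (C / (shiftEntropy μ + ∫ x, ψ x ∂μ)))
  obtain ⟨hn1, hn2⟩ := max_lt_iff.1 hn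
  rw [div_lt_iff₀ hpos] at hn2
  exact absurd (key' n (by exact_mod_cast hn1.le)) (not_le.2 hn2)

variable [TopologicalSpace S] [DiscreteTopology S]

/-- An invariant measure fixed by the dual of the transfer operator attains the supremum `0` in
the variational principle. -/
lemma neg_integral_le_shiftEntropy {φp : (ℕ → S) → ℝ} (hφp : Continuous φp)
    {ν : Measure (ℕ → S)} [IsProbabilityMeasure ν]
    (hinv : MeasurePreserving leftShift ν ν)
    (hν : ∀ f : (ℕ → S) → ℝ, Continuous f → ∫ x, transferOp φp f x ∂ν = ∫ x, f x ∂ν) :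
    -∫ x, φp x ∂ν ≤ shiftEntropy ν := by
  have hνn : ∀ (n : ℕ) (f : (ℕ → S) → ℝ), Continuous f →
      ∫ x, (transferOp φp)^[n] f x ∂ν = ∫ x, f x ∂ν := by
    intro n
    induction n with
    | zero => intro f _; rfl
    | succ n ih =>
      intro f hf
      rw [Function.iterate_succ_apply, ih _ (continuous_transferOp hφp hf), hν f hf]
  have hB : ∀ n, Continuous (birkhoffSum leftShift φp n) := fun n =>
    continuous_finsetSum _ fun k _ => hφp.comp (continuous_leftShift.iterate k)
  have hwA : ∀ n (w : Fin n → S), Continuous (wordAppend n w) := by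
    intro n
    induction n with
    | zero => exact fun _ => continuous_id
    | succ n ih => exact fun w => (continuous_prepend _).comp (ih (Fin.tail w))
  refine le_shiftEntropy fun n => ?_
  set g : (Fin n → S) → (ℕ → S) → ℝ := fun w x =>
    Real.exp (birkhoffSum leftShift φp n (wordAppend n w x)) with hg
  have hgc : ∀ w, Continuous (g w) := fun w =>
    Real.continuous_exp.comp ((hB n).comp (hwA n w))
  -- `P ^ n` maps the indicator of the cylinder to `g w`; the indicator is continuous since
  -- cylinders are clopen.
  have hcyl : ∀ w : Fin n → S, ν.real (cyl w) = ∫ x, g w x ∂ν := by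
    intro w
    have hclopen : IsClopen (cyl w) := by
      have : cyl w = ⋂ i : Fin n, (fun x : ℕ → S => x i) ⁻¹' {w i} := by
        ext x; simp [cyl]
      rw [this]
      exact isClopen_iInter_of_finite fun i =>
        (isClopen_discrete _).preimage (continuous_apply (i : ℕ))
    have hc : Continuous ((cyl w).indicator (fun _ => (1 : ℝ))) :=
      continuous_const.indicator fun x hx => by simp [hclopen.frontier_eq] at hx
    have h1 := hνn n _ hc
    rw [integral_indicator (measurableSet_cyl w), setIntegral_const, smul_eq_mul, mul_one] at h1
    rw [← h1]
    congr 1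
    funext x
    rw [iterate_transferOp_eq_sum_words, Finset.sum_eq_single w]
    · rw [Set.indicator_of_mem (show wordAppend n w x ∈ cyl w from wordAppend_apply x n w),
        mul_one]
    · intro w' _ hne
      rw [Set.indicator_of_notMem, mul_zero]
      intro hmem
      exact hne (funext fun i => (wordAppend_apply x n w' i).symm.trans (hmem i))
    · simp
  -- Jensen's inequality.
  have hterm : ∀ w : Fin n → S, ∫ x, Real.negMulLog (g w x) ∂ν
      ≤ Real.negMulLog (ν.real (cyl w)) := by
    intro w
    rw [hcyl w]
    exact Real.concaveOn_negMulLog.le_map_integral Real.continuous_negMulLog.continuousOn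
      isClosed_Ici (Filter.Eventually.of_forall fun x => (Real.exp_pos _).le)
      ((hgc w).integrable_of_seq ν)
      ((Real.continuous_negMulLog.comp (hgc w)).integrable_of_seq ν)
  calc (n : ℝ) * -∫ x, φp x ∂ν = -∫ x, (transferOp φp)^[n] (birkhoffSum leftShift φp n) x ∂ν := by
        rw [hνn n _ (hB n), integral_birkhoffSum hinv (hφp.integrable_of_seq ν)]
        ring
    _ = ∫ x, ∑ w : Fin n → S, Real.negMulLog (g w x) ∂ν := by
        rw [← integral_neg]
        congr 1
        funext x
        rw [iterate_transferOp_eq_sum_words, ← Finset.sum_neg_distrib]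
        refine Finset.sum_congr rfl fun w _ => ?_
        rw [Real.negMulLog, hg, Real.log_exp, neg_mul]
    _ = ∑ w : Fin n → S, ∫ x, Real.negMulLog (g w x) ∂ν :=
        integral_finsetSum _ fun w _ =>
          (Real.continuous_negMulLog.comp (hgc w)).integrable_of_seq ν
    _ ≤ blockEntropy ν n := Finset.sum_le_sum fun w _ => hterm w

end Entropy

/-! ### A fixed measure of the dual operator. -/

section Existence

variable {S : Type*} [Fintype S] [MeasurableSpace S] [DiscreteMeasurableSpace S]
  [TopologicalSpace S] [DiscreteTopology S]

open CompactlySupported in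
/-- A normalized continuous potential has an invariant measure fixed by the dual of its
transfer operator. -/
lemma exists_invariant_transferOp {φp : (ℕ → S) → ℝ} (hφp : Continuous φp)
    (hnorm : IsNormalized φp) (x₀ : ℕ → S) :
    ∃ ν : Measure (ℕ → S), IsProbabilityMeasure ν ∧ MeasurePreserving leftShift ν ν ∧
      ∀ f : (ℕ → S) → ℝ, Continuous f → ∫ x, transferOp φp f x ∂ν = ∫ x, f x ∂ν := by
  set A : ((ℕ → S) → ℝ) → ℕ → ℝ := fun f n =>
    (n + 1 : ℝ)⁻¹ * ∑ k ∈ Finset.range (n + 1), (transferOp φp)^[k] f x₀ with hA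
  have hbound : ∀ f : (ℕ → S) → ℝ, Continuous f → ∃ M, ∀ x, |f x| ≤ M := by
    intro f hf
    obtain ⟨M, hM⟩ := isCompact_univ.exists_bound_of_continuousOn hf.continuousOn
    exact ⟨M, fun x => hM x (Set.mem_univ x)⟩
  have hlim : ∀ f : C_c(ℕ → S, ℝ), ∃ l : ℝ,
      Filter.Tendsto (A f) (Filter.hyperfilter ℕ : Filter ℕ) (nhds l) := by
    intro f
    obtain ⟨M, hM⟩ := hbound f f.continuous
    have hmem : ∀ n, A f n ∈ Set.Icc (-M) M := by
      intro n
      rw [Set.mem_Icc, ← abs_le, hA]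
      dsimp only
      have hn : (0 : ℝ) < n + 1 := by positivity
      rw [abs_mul, abs_of_pos (inv_pos.2 hn), inv_mul_le_iff₀ hn]
      refine (Finset.abs_sum_le_sum_abs _ _).trans
        ((Finset.sum_le_sum fun k _ => abs_iterate_transferOp_le hnorm hM k x₀).trans ?_)
      simp
    -- A single ultrafilter gives limits of the Cesàro means for all `f` at once, so the limit is
    -- linear in `f`.
    obtain ⟨l, -, hl⟩ := (isCompact_Icc (a := -M) (b := M)).ultrafilter_le_nhds
      ((Filter.hyperfilter ℕ).map (A f))
      (Filter.tendsto_principal.2 (Filter.Eventually.of_forall hmem))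
    exact ⟨l, hl⟩
  choose Λ hΛ using hlim
  have hadd : ∀ f g, Λ (f + g) = Λ f + Λ g := by
    intro f g
    refine tendsto_nhds_unique (hΛ (f + g)) (((hΛ f).add (hΛ g)).congr fun n => ?_)
    simp only [hA, CompactlySupportedContinuousMap.coe_add, iterate_transferOp_add,
      Pi.add_apply, Finset.sum_add_distrib, mul_add]
  have hsmul : ∀ (c : ℝ) f, Λ (c • f) = c * Λ f := by
    intro c f
    refine tendsto_nhds_unique (hΛ (c • f)) (((hΛ f).const_mul c).congr fun n => ?_)
    simp only [hA, CompactlySupportedContinuousMap.coe_smul, iterate_transferOp_smul,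
      Pi.smul_apply, smul_eq_mul, ← Finset.mul_sum]
    ring
  have hpos : ∀ f, 0 ≤ f → 0 ≤ Λ f := by
    intro f hf
    refine ge_of_tendsto' (hΛ f) fun n => ?_
    exact mul_nonneg (by positivity) (Finset.sum_nonneg fun k _ =>
      iterate_transferOp_nonneg (f := f) (fun x => hf x) k x₀)
  let Λ' : C_c(ℕ → S, ℝ) →ₚ[ℝ] ℝ := PositiveLinearMap.mk₀
    { toFun := Λ, map_add' := hadd, map_smul' := hsmul } hpos
  set ν := RealRMK.rieszMeasure Λ' with hνdef
  have hν : ∀ f : C_c(ℕ → S, ℝ), ∫ x, f x ∂ν = Λ f := RealRMK.integral_rieszMeasure Λ'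
  let mk : ∀ f : (ℕ → S) → ℝ, Continuous f → C_c(ℕ → S, ℝ) := fun f hf =>
    ⟨⟨f, hf⟩, HasCompactSupport.of_compactSpace f⟩
  have hprob : IsProbabilityMeasure ν := by
    have : IsFiniteMeasure ν := ⟨isCompact_univ.measure_lt_top⟩
    have h1 := hν (mk (fun _ => 1) continuous_const)
    have h2 : Λ (mk (fun _ => 1) continuous_const) = 1 := by
      refine tendsto_nhds_unique (hΛ _) (tendsto_const_nhds.congr fun n => ?_)
      change (1 : ℝ) = (n + 1 : ℝ)⁻¹ * ∑ k ∈ Finset.range (n + 1),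
        (transferOp φp)^[k] (fun _ => 1) x₀
      simp only [iterate_transferOp_const hnorm]
      have : (n + 1 : ℝ) ≠ 0 := by positivity
      simp [this]
    have h3 : ∫ x, (1 : ℝ) ∂ν = 1 := h1.trans h2
    rw [integral_const, smul_eq_mul, mul_one] at h3
    exact ⟨by rw [← ENNReal.toReal_eq_one_iff]; exact h3⟩
  have hP : ∀ f : (ℕ → S) → ℝ, Continuous f → ∫ x, transferOp φp f x ∂ν = ∫ x, f x ∂ν := by
    intro f hf
    have hPf := continuous_transferOp hφp hf
    refine (hν (mk _ hPf)).trans (Eq.trans ?_ (hν (mk f hf)).symm)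
    -- The Cesàro sums telescope to two bounded terms divided by `n + 1`.
    have hdiff : Filter.Tendsto (fun n => A (transferOp φp f) n - A f n) Filter.atTop (nhds 0) := by
      obtain ⟨M, hM⟩ := hbound f hf
      have hz : Filter.Tendsto (fun n : ℕ => 2 * M * (1 / ((n : ℝ) + 1))) Filter.atTop (nhds 0) := by
        simpa using tendsto_one_div_add_atTop_nhds_zero_nat.const_mul (2 * M)
      refine squeeze_zero_norm (fun n => ?_) hz
      have e : A (transferOp φp f) n - A f n
          = (n + 1 : ℝ)⁻¹ * ((transferOp φp)^[n + 1] f x₀ - f x₀) := by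
        simp only [hA]
        rw [← mul_sub, ← Finset.sum_sub_distrib]
        simp only [← Function.iterate_succ_apply]
        rw [Finset.sum_range_sub (fun k => (transferOp φp)^[k] f x₀)]
        rfl
      have hn : (0 : ℝ) < n + 1 := by positivity
      rw [e, Real.norm_eq_abs, abs_mul, abs_of_pos (inv_pos.2 hn), one_div, mul_comm]
      refine mul_le_mul_of_nonneg_right ?_ (inv_pos.2 hn).le
      have h1 := abs_iterate_transferOp_le hnorm hM (n + 1) x₀
      have h2 := abs_sub ((transferOp φp)^[n + 1] f x₀) (f x₀)
      linarith [hM x₀]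
    have h1 := (hΛ (mk _ hPf)).sub (hΛ (mk f hf))
    have h2 := tendsto_nhds_unique h1 (hdiff.mono_left Nat.hyperfilter_le_atTop)
    exact sub_eq_zero.1 h2
  refine ⟨ν, hprob, ⟨measurable_leftShift, ?_⟩, hP⟩
  have : IsProbabilityMeasure (ν.map leftShift) :=
    Measure.isProbabilityMeasure_map measurable_leftShift.aemeasurable
  refine ext_of_forall_integral_eq_of_IsFiniteMeasure fun f => ?_
  rw [integral_map measurable_leftShift.aemeasurable
    f.continuous.measurable.aestronglyMeasurable,
    ← hP (fun x => f (leftShift x)) (f.continuous.comp continuous_leftShift),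
    transferOp_comp_leftShift hnorm f]

end Existence

/-! ### Equilibrium states are fixed by the dual operator. -/

section Equilibrium

variable {S : Type*} [Fintype S] [MeasurableSpace S] [DiscreteMeasurableSpace S]

lemma self_sub_two_mul_sq_le_log_one_add {u : ℝ} (hu : |u| ≤ 1 / 2) :
    u - 2 * u ^ 2 ≤ Real.log (1 + u) := by
  obtain ⟨h1, h2⟩ := abs_le.1 hu
  have hpos : 0 < 1 + u := by linarith
  refine le_trans ?_ (Real.one_sub_inv_le_log_of_pos hpos)
  have e : 1 - (1 + u)⁻¹ = u / (1 + u) := by field_simp; ring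
  rw [e, le_div_iff₀ hpos]
  linarith [mul_nonneg (sq_nonneg u) (by linarith : 0 ≤ 1 + 2 * u)]

/-- Perturbing a normalized potential along fibrewise centred directions. -/
lemma integral_le_zero_of_maximal {θ : ℝ} (hθ : θ ∈ Set.Ioo (0 : ℝ) 1)
    {φp : (ℕ → S) → ℝ} (hφp : HasLip θ φp) (hnorm : IsNormalized φp)
    {μ : Measure (ℕ → S)} [IsProbabilityMeasure μ] (hμ : MeasurePreserving leftShift μ μ)
    (hmax : 0 ≤ shiftEntropy μ + ∫ x, φp x ∂μ)
    {g : (ℕ → S) → ℝ} (hg : HasLip θ g) (hPg : transferOp φp g = 0) :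
    ∫ x, g x ∂μ ≤ 0 := by
  let _ : TopologicalSpace S := ⊥
  have : DiscreteTopology S := ⟨rfl⟩
  obtain ⟨M₀, hM₀, hgM₀⟩ := hg.exists_abs_le
  obtain ⟨M, hM, hgM⟩ : ∃ M, 0 < M ∧ ∀ x, |g x| ≤ M :=
    ⟨M₀ + 1, by linarith, fun x => (hgM₀ x).trans (by linarith)⟩
  have key : ∀ t : ℝ, 0 < t → t * M ≤ 1 / 2 → ∫ x, g x ∂μ ≤ t * (2 * M ^ 2) := by
    intro t ht htM
    have hu : ∀ x, |t * g x| ≤ t * M := fun x => by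
      rw [abs_mul, abs_of_pos ht]; exact mul_le_mul_of_nonneg_left (hgM x) ht.le
    have hlow : ∀ x, 1 / 2 ≤ 1 + t * g x := fun x => by
      linarith [(abs_le.1 ((hu x).trans htM)).1]
    have hlog : HasLip θ fun x => Real.log (1 + t * g x) :=
      ((HasLip.const 1).add (hg.const_mul t)).comp (u := Real.log) (by norm_num)
        fun x y => abs_log_sub_log_le (by norm_num : (0 : ℝ) < 1 / 2) (hlow x) (hlow y)
    -- The weights become `exp φp * (1 + t * g)`, whose sum is `1 + t * P g = 1`.
    have hψnorm : IsNormalized fun x => φp x + Real.log (1 + t * g x) := by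
      intro x
      have h1 : ∀ s, Real.exp (φp (prepend s x) + Real.log (1 + t * g (prepend s x)))
          = Real.exp (φp (prepend s x))
            + t * (Real.exp (φp (prepend s x)) * g (prepend s x)) := by
        intro s
        rw [Real.exp_add, Real.exp_log (by linarith [hlow (prepend s x)])]
        ring
      simp only [h1, Finset.sum_add_distrib, ← Finset.mul_sum]
      rw [hnorm x, show ∑ s, Real.exp (φp (prepend s x)) * g (prepend s x) = 0 from
        congrFun hPg x]
      ring
    have h1 := shiftEntropy_add_integral_le_zero hθ (hφp.add hlog) hψnorm hμ
    rw [integral_add (hφp.integrable hθ μ) (hlog.integrable hθ μ)] at h1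
    have h2 : ∫ x, (t * g x - 2 * (t ^ 2 * M ^ 2)) ∂μ ≤ ∫ x, Real.log (1 + t * g x) ∂μ := by
      refine integral_mono (((hg.const_mul t).integrable hθ μ).sub (integrable_const _))
        (hlog.integrable hθ μ) fun x => ?_
      refine le_trans ?_ (self_sub_two_mul_sq_le_log_one_add ((hu x).trans htM))
      have := sq_le_sq' (neg_le_of_abs_le (hu x)) (le_of_abs_le (hu x))
      rw [mul_pow] at this
      simp only
      linarith
    rw [integral_sub ((hg.const_mul t).integrable hθ μ) (integrable_const _),
      integral_const_mul, integral_const, probReal_univ, one_smul] at h2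
    have h3 : t * ∫ x, g x ∂μ ≤ t * (t * (2 * M ^ 2)) := by linarith
    exact le_of_mul_le_mul_left h3 ht
  by_contra! hpos
  set I := ∫ x, g x ∂μ
  -- The first bound keeps `|t * g| ≤ 1 / 2`; the second makes the quadratic error at most `I / 2`,
  -- contradicting `key`.
  set t := min (1 / (2 * M)) (I / (4 * M ^ 2))
  have ht : 0 < t := lt_min (by positivity) (by positivity)
  have h1 : t * M ≤ 1 / 2 := by
    have : t ≤ 1 / (2 * M) := min_le_left _ _
    rw [le_div_iff₀ (by positivity)] at this
    linarith
  have h2 : t * (2 * M ^ 2) ≤ I / 2 := by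
    have : t ≤ I / (4 * M ^ 2) := min_le_right _ _
    rw [le_div_iff₀ (by positivity)] at this
    linarith
  linarith [key t ht h1]

/-- An equilibrium state is fixed by the dual of the transfer operator. -/
lemma IsEquilibriumState.integral_transferOp {θ : ℝ} (hθ : θ ∈ Set.Ioo (0 : ℝ) 1)
    {φp : (ℕ → S) → ℝ} (hφp : HasLip θ φp) (hnorm : IsNormalized φp)
    {μ : Measure (ℕ → S)} (hμ : IsEquilibriumState φp μ)
    {f : (ℕ → S) → ℝ} (hf : HasLip θ f) :
    ∫ x, transferOp φp f x ∂μ = ∫ x, f x ∂μ := by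
  let _ : TopologicalSpace S := ⊥
  have : DiscreteTopology S := ⟨rfl⟩
  have := hμ.isProb
  obtain ⟨x₀⟩ : Nonempty (ℕ → S) := nonempty_of_isProbabilityMeasure μ
  have hφc := hφp.continuous hθ
  have hmax : 0 ≤ shiftEntropy μ + ∫ x, φp x ∂μ := by
    obtain ⟨ν, hprob, hinv, hν⟩ := exists_invariant_transferOp hφc hnorm x₀
    have h1 := neg_integral_le_shiftEntropy hφc hinv hν
    linarith [hμ.maximal ν hprob hinv]
  have hPf := hφp.transferOp hθ hf
  have hPfs := hPf.comp_leftShift hθ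
  have hg : HasLip θ fun x => f x + (-1) * transferOp φp f (leftShift x) :=
    hf.add (hPfs.const_mul (-1))
  have hPg : transferOp φp (fun x => f x + (-1) * transferOp φp f (leftShift x)) = 0 := by
    have e : (fun x => f x + (-1) * transferOp φp f (leftShift x))
        = f + (-1 : ℝ) • fun x => transferOp φp f (leftShift x) := rfl
    rw [e, transferOp_add, transferOp_smul, transferOp_comp_leftShift hnorm]
    simp
  have h1 := integral_le_zero_of_maximal hθ hφp hnorm hμ.invariant hmax hg hPg
  have h2 := integral_le_zero_of_maximal hθ hφp hnorm hμ.invariant hmax (hg.const_mul (-1))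
    (by
      have := transferOp_smul (φp := φp) (-1)
        (fun x => f x + (-1) * transferOp φp f (leftShift x))
      rw [hPg, smul_zero] at this
      exact this)
  rw [integral_const_mul] at h2
  have h3 : ∫ x, (f x + (-1) * transferOp φp f (leftShift x)) ∂μ
      = ∫ x, f x ∂μ - ∫ x, transferOp φp f x ∂μ := by
    rw [integral_add (hf.integrable hθ μ) ((hPfs.const_mul (-1)).integrable hθ μ),
      integral_const_mul, integral_comp_leftShift hμ.invariant (hPf.integrable hθ μ)]
    ring
  linarith

/-- The centred iterates are bounded by the oscillation of the iterates. -/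
lemma IsEquilibriumState.abs_iterate_sub_integral_le {θ : ℝ} (hθ : θ ∈ Set.Ioo (0 : ℝ) 1)
    {φp : (ℕ → S) → ℝ} (hφp : HasLip θ φp) (hnorm : IsNormalized φp)
    {μ : Measure (ℕ → S)} (hμ : IsEquilibriumState φp μ)
    {f : (ℕ → S) → ℝ} (hf : HasLip θ f) {n : ℕ} {x : ℕ → S} {C : ℝ}
    (hC : ∀ y, |(transferOp φp)^[n] f x - (transferOp φp)^[n] f y| ≤ C) :
    |(transferOp φp)^[n] (fun y => f y - ∫ w, f w ∂μ) x| ≤ C := by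
  let _ : TopologicalSpace S := ⊥
  have : DiscreteTopology S := ⟨rfl⟩
  have := hμ.isProb
  have hiter : ∀ n, HasLip θ ((transferOp φp)^[n] f) ∧
      ∫ y, (transferOp φp)^[n] f y ∂μ = ∫ y, f y ∂μ := by
    intro n
    induction n with
    | zero => exact ⟨hf, rfl⟩
    | succ n ih =>
      rw [Function.iterate_succ_apply']
      exact ⟨hφp.transferOp hθ ih.1, (hμ.integral_transferOp hθ hφp hnorm ih.1).trans ih.2⟩
  -- Since `μ` is fixed by the dual, the mean of `f` is also the mean of `P ^ n f`.
  have e : (transferOp φp)^[n] (fun y => f y - ∫ w, f w ∂μ) x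
      = ∫ y, ((transferOp φp)^[n] f x - (transferOp φp)^[n] f y) ∂μ := by
    have h1 : (fun y => f y - ∫ w, f w ∂μ) = f + fun _ => -∫ w, f w ∂μ := by
      funext y; simp [sub_eq_add_neg]
    rw [h1, iterate_transferOp_add, iterate_transferOp_const hnorm,
      integral_sub (integrable_const _) ((hiter n).1.integrable hθ μ), (hiter n).2,
      integral_const, probReal_univ, one_smul, Pi.add_apply, sub_eq_add_neg]
  rw [e, ← Real.norm_eq_abs]
  refine (norm_integral_le_of_norm_le_const (Filter.Eventually.of_forall hC)).trans ?_
  rw [probReal_univ, mul_one]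

end Equilibrium

theorem theorem1 {S : Type*} [Fintype S] [MeasurableSpace S] [DiscreteMeasurableSpace S]
    (θ : ℝ) (hθ : θ ∈ Set.Ioo (0 : ℝ) 1)
    -- the potential, with its constant `Kp` (written `‖φ_p‖`), and its equilibrium state
    (φp : (ℕ → S) → ℝ) (Kp : ℝ) (hφp : IsLipBound θ φp Kp) (hnorm : IsNormalized φp)
    (μ : MeasureTheory.Measure (ℕ → S)) (hμ : IsEquilibriumState φp μ)
    -- the observable, with its constant `K` (written `‖φ‖`)
    (φ : (ℕ → S) → ℝ) (K : ℝ) (hφ : IsLipBound θ φ K)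
    (a ε U z₀ : ℝ)
    (ha : a = 1 - Real.exp (-(Kp * (1 - θ)⁻¹)))
    (hε : ε ∈ Set.Ioo 0 (min (1 - a) (1 - θ)))
    (hU : U = Real.log (1 - ε) / (Real.log (θ * ε * (1 - ε - θ)) - Real.log (2 * Kp)))
    (hz₀ : z₀ ∈ Set.Ioo 1
      (min (((a + ε / 2) / a) ^ U)
        (min ((θ + ε) / θ) (min ((1 - ε) / θ) (Real.exp 2)))))
    (n : ℕ) (x : ℕ → S) :
    |((transferOp φp)^[n] (fun y => φ y - ∫ w, φ w ∂μ)) x| ≤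
      (Real.sqrt z₀ ^ n)⁻¹ / (Real.log (Real.sqrt z₀) * (1 - a - ε)) * K :=
  hμ.abs_iterate_sub_integral_le hθ (hφp.hasLip hθ) hnorm (hφ.hasLip hθ)
    (abs_iterate_transferOp_sub_le_of_params hθ hφp hnorm hφ ha hε hU hz₀ n x)
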